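/- Let $n\ge 1$. For every constant $C$ there exists $\varepsilon_0=\varepsilon_0(C,n)>0$ with the following property. Let $n-\varepsilon_0<\alpha<n$ and $\frac n2<\beta<n$, and let $E\subseteq\mathbb{R}^n$ be a set of Lebesgue measure zero which contains the (closed) support of a non-zero, finite Borel measure $\mu$ such that \[ \sup_{x\in E,\;0<r<1}\frac{\mu(B(x;r))}{r^{\alpha}}\le C \qquad\text{and}\qquad \sup_{\xi\in\mathbb{R}^n}|\widehat{\mu}(\xi)|\,(1+|\xi|)^{\beta/2}\le C, \] where $\widehat{\mu}(\xi)=\int e^{-2\pi i x\cdot\xi}\,d\mu(x)$. Then $E$ contains a parallelogram $\{x,\,x+y,\,x+z,\,x+y+z\}$ with $x,y,z\in\mathbb{R}^n$, where the four points are all distinct. -/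

import Mathlib

open MeasureTheory

/-- The Fourier transform `ξ ↦ ∫ exp(-2πi x·ξ) dμ(x)` of a finite Borel measure on `ℝⁿ`. -/
noncomputable def measureFourier {n : ℕ} (μ : Measure (EuclideanSpace ℝ (Fin n)))
    (ξ : EuclideanSpace ℝ (Fin n)) : ℂ :=
  ∫ x, Complex.exp (-(2 * Real.pi * Complex.I * (inner ℝ x ξ : ℝ))) ∂μ

/-- The ball condition: `sup { μ(B(x;r)) / r^α : x ∈ E, 0 < r < 1 } ≤ C`. -/
def BallCondition {n : ℕ} (E : Set (EuclideanSpace ℝ (Fin n)))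
    (μ : Measure (EuclideanSpace ℝ (Fin n))) (α C : ℝ) : Prop :=
  ∀ x ∈ E, ∀ r : ℝ, 0 < r → r < 1 → μ.real (Metric.ball x r) / r ^ α ≤ C

/-- The Fourier decay condition: `sup { |μ̂(ξ)| (1 + |ξ|)^(β/2) : ξ ∈ ℝⁿ } ≤ C`. -/
def FourierDecay {n : ℕ} (μ : Measure (EuclideanSpace ℝ (Fin n))) (β C : ℝ) : Prop :=
  ∀ ξ : EuclideanSpace ℝ (Fin n), ‖measureFourier μ ξ‖ * (1 + ‖ξ‖) ^ (β / 2) ≤ C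

/-- `E` contains a parallelogram `{x, x + y, x + z, x + y + z}` with four distinct points. -/
def ContainsParallelogram {n : ℕ} (E : Set (EuclideanSpace ℝ (Fin n))) : Prop :=
  ∃ x y z : EuclideanSpace ℝ (Fin n),
    {x, x + y, x + z, x + y + z} ⊆ E ∧ [x, x + y, x + z, x + y + z].Nodup

/-! ### Gaussian mollifiers and their Fourier expansion. -/

section GaussianKernel

/-! A parallelogram is a nonzero difference realised twice. The ball condition rules out atoms, so
the support contains two distinct points; restrict `μ` to disjoint closed balls around them. The
difference laws `ν₁`, `ν₂` of the two pieces have nonnegative Fourier transforms and are dominated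
by `ν = differenceLaw μ`, whose transform decays like `(1 + ‖ξ‖) ^ (-β)` and is square integrable
because `β > n / 2`.

Suppose the two compact difference sets meet only at `0`. By positivity on the Fourier side, the
correlation of `ν₁` and `ν₂` mollified at scale `t` stays above some `c > 0` as `t → 0`
(`exists_le_integral_gaussKernel`). Away from the origin the sets are separated, so that part of the
correlation tends to `0`. Near the origin it is at most the correlation energy of `ν` there, which
is small uniformly in `t` (`exists_tendsto_integral_gaussKernel_le`). This contradiction is
`exists_mem_inter_ne_zero`. -/

lemma norm_cexp_neg_mul_sq_norm {V : Type*} [NormedAddCommGroup V] (t : ℝ) (ξ : V) :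
    ‖Complex.exp (-t * ‖ξ‖ ^ 2)‖ = Real.exp (-t * ‖ξ‖ ^ 2) := by
  rw [Complex.norm_exp]
  congr 1
  norm_cast

/-- Since `1 + ‖ζ‖ ≤ (1 + ‖ξ + ζ‖) * (1 + ‖ξ‖)`, spending `κ` of the exponent buys decay in `ζ`;
AM-GM separates what remains. -/
lemma one_add_norm_rpow_mul_le {V : Type*} [NormedAddCommGroup V] {β κ : ℝ}
    (hκ : 0 ≤ κ) (ξ ζ : V) :
    (1 + ‖ξ + ζ‖) ^ (-β) * (1 + ‖ξ‖) ^ (-β) ≤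
      (1 + ‖ζ‖) ^ (-κ) * ((1 + ‖ξ + ζ‖) ^ (-(2 * (β - κ))) + (1 + ‖ξ‖) ^ (-(2 * (β - κ)))) := by
  have ha : 0 < 1 + ‖ξ + ζ‖ := by positivity
  have hb : 0 < 1 + ‖ξ‖ := by positivity
  have hc : 0 < 1 + ‖ζ‖ := by positivity
  have hle : 1 + ‖ζ‖ ≤ (1 + ‖ξ + ζ‖) * (1 + ‖ξ‖) := by
    have : ‖ζ‖ ≤ ‖ξ + ζ‖ + ‖ξ‖ := by
      simpa using norm_sub_le (ξ + ζ) ξ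
    nlinarith [norm_nonneg (ξ + ζ), norm_nonneg ξ]
  have h1 : ((1 + ‖ξ + ζ‖) * (1 + ‖ξ‖)) ^ (-κ) ≤ (1 + ‖ζ‖) ^ (-κ) :=
    Real.rpow_le_rpow_of_nonpos hc hle (by linarith)
  have hsplit : ∀ {r : ℝ}, 0 < r → r ^ (-β) = r ^ (-κ) * r ^ (-(β - κ)) := fun hr => by
    rw [← Real.rpow_add hr]; congr 1; ring
  have hsq : ∀ {r : ℝ}, 0 < r → r ^ (-(2 * (β - κ))) = (r ^ (-(β - κ))) ^ 2 := fun hr => by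
    rw [← Real.rpow_natCast, ← Real.rpow_mul hr.le]; congr 1; push_cast; ring
  rw [hsplit ha, hsplit hb, hsq ha, hsq hb]
  rw [Real.mul_rpow ha.le hb.le] at h1
  set A := (1 + ‖ξ + ζ‖) ^ (-(β - κ))
  set B := (1 + ‖ξ‖) ^ (-(β - κ))
  have hA : 0 < A := Real.rpow_pos_of_pos ha _
  have hB : 0 < B := Real.rpow_pos_of_pos hb _
  calc _ = ((1 + ‖ξ + ζ‖) ^ (-κ) * (1 + ‖ξ‖) ^ (-κ)) * (A * B) := by ring
    _ ≤ (1 + ‖ζ‖) ^ (-κ) * (A ^ 2 + B ^ 2) := by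
        refine mul_le_mul h1 ?_ (by positivity) (by positivity)
        nlinarith [sq_nonneg (A - B), mul_pos hA hB]


variable {V : Type*} [NormedAddCommGroup V] [InnerProductSpace ℝ V]

/-- The Fourier transform of `ξ ↦ exp (-t ‖ξ‖²)`. -/
noncomputable def gaussKernel (t : ℝ) (x : V) : ℝ :=
  (Real.pi / t) ^ (Module.finrank ℝ V / 2 : ℝ) * Real.exp (-(‖x‖ ^ 2 / (4 * t)))

lemma gaussKernel_nonneg {t : ℝ} (ht : 0 < t) (x : V) : 0 ≤ gaussKernel t x := by
  unfold gaussKernel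
  positivity

lemma continuous_gaussKernel (t : ℝ) : Continuous (gaussKernel (V := V) t) := by
  unfold gaussKernel
  fun_prop

lemma gaussKernel_le {t : ℝ} (ht : 0 < t) (x : V) :
    gaussKernel t x ≤ (Real.pi / t) ^ (Module.finrank ℝ V / 2 : ℝ) := by
  unfold gaussKernel
  refine mul_le_of_le_one_right (by positivity) (Real.exp_le_one_iff.2 ?_)
  have : 0 ≤ ‖x‖ ^ 2 / (4 * t) := by positivity
  linarith

lemma gaussKernel_le_of_le_norm {t r : ℝ} (ht : 0 < t) (hr : 0 ≤ r) {x : V} (hx : r ≤ ‖x‖) :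
    gaussKernel t x ≤
      (Real.pi / t) ^ (Module.finrank ℝ V / 2 : ℝ) * Real.exp (-(r ^ 2 / (4 * t))) := by
  unfold gaussKernel
  gcongr

variable [FiniteDimensional ℝ V] [MeasurableSpace V] [BorelSpace V]

lemma gaussKernel_eq_integral {t : ℝ} (ht : 0 < t) (x : V) :
    (gaussKernel t x : ℂ) =
      ∫ ξ : V, Complex.exp (-t * ‖ξ‖ ^ 2) * Complex.exp ((inner ℝ x ξ : ℝ) * Complex.I) := by
  have h := GaussianFourier.integral_cexp_neg_mul_sq_norm_add (V := V) (b := (t : ℂ))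
    (by simpa using ht) Complex.I x
  simp_rw [← Complex.exp_add, mul_comm _ Complex.I]
  rw [h, gaussKernel]
  push_cast
  rw [Complex.ofReal_cpow (by positivity)]
  push_cast
  congr 2
  rw [Complex.I_sq]
  ring

lemma integrable_exp_neg_mul_sq_norm {t : ℝ} (ht : 0 < t) :
    Integrable (fun ξ : V => Real.exp (-t * ‖ξ‖ ^ 2)) := by
  have h := (GaussianFourier.integrable_cexp_neg_mul_sq_norm_add (V := V) (b := (t : ℂ))
    (by simpa using ht) 0 0).norm
  refine h.congr (Filter.Eventually.of_forall fun ξ => ?_)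
  simp only [zero_mul, add_zero]
  rw [Complex.norm_exp]
  congr 1
  norm_cast

/-- Fubini for a Gaussian average of characters. -/
lemma integral_mul_gaussKernel {Ω : Type*} [MeasurableSpace Ω] (ρ : Measure Ω) [IsFiniteMeasure ρ]
    {t : ℝ} (ht : 0 < t) {u : Ω → V} (hu : Measurable u) {f : Ω → ℂ} (hf : Integrable f ρ) :
    ∫ p, f p * (gaussKernel t (u p) : ℂ) ∂ρ =
      ∫ ξ : V, Complex.exp (-t * ‖ξ‖ ^ 2) *
        ∫ p, f p * Complex.exp ((inner ℝ (u p) ξ : ℝ) * Complex.I) ∂ρ := by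
  simp_rw [gaussKernel_eq_integral ht, ← integral_const_mul]
  rw [integral_integral_swap]
  · refine integral_congr_ae (Filter.Eventually.of_forall fun ξ => ?_)
    refine integral_congr_ae (Filter.Eventually.of_forall fun p => ?_)
    simp only
    ring
  · have h := hf.mul_prod ((integrable_exp_neg_mul_sq_norm (V := V) ht).ofReal (𝕜 := ℂ))
    refine h.mono ?_ (Filter.Eventually.of_forall fun p => ?_)
    · refine (hf.1.comp_fst).mul (Measurable.aestronglyMeasurable ?_)
      fun_prop
    · simp only [Function.uncurry, norm_mul, Complex.norm_exp_ofReal_mul_I, mul_one,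
        norm_cexp_neg_mul_sq_norm, Complex.coe_algebraMap, Complex.norm_real, Real.norm_eq_abs,
        Real.abs_exp, le_refl]

/-- Parseval with Gaussian damping; the character shifts the frequency of the first factor. -/
lemma integral_gaussKernel_sub_mul_char (ν₁ ν₂ : Measure V) [IsFiniteMeasure ν₁]
    [IsFiniteMeasure ν₂] {t : ℝ} (ht : 0 < t) (ζ : V) :
    ∫ p, Complex.exp ((inner ℝ p.1 ζ : ℝ) * Complex.I) * (gaussKernel t (p.1 - p.2) : ℂ)
        ∂(ν₁.prod ν₂) =
      ∫ ξ : V, Complex.exp (-t * ‖ξ‖ ^ 2) * (charFun ν₁ (ξ + ζ) * charFun ν₂ (-ξ)) := by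
  rw [integral_mul_gaussKernel (ν₁.prod ν₂) ht (u := fun p : V × V => p.1 - p.2) (by fun_prop)]
  · refine integral_congr_ae (Filter.Eventually.of_forall fun ξ => ?_)
    simp only [charFun_apply]
    congr 1
    rw [← integral_prod_mul]
    refine integral_congr_ae (Filter.Eventually.of_forall fun p => ?_)
    simp only [← Complex.exp_add]
    congr 1
    simp only [inner_sub_left, inner_add_right, inner_neg_right]
    push_cast
    ring
  · refine Integrable.of_bound (C := 1) (Measurable.aestronglyMeasurable (by fun_prop)) ?_
    exact Filter.Eventually.of_forall fun p => by rw [Complex.norm_exp_ofReal_mul_I]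

/-- The autocorrelation of `(1 + ‖·‖) ^ (-β)` decays as soon as this function is
square integrable. -/
lemma exists_integral_one_add_norm_rpow_mul_le {β : ℝ}
    (hβ : (Module.finrank ℝ V : ℝ) < 2 * β) :
    ∃ κ : ℝ, 0 < κ ∧ ∃ M : ℝ, 0 ≤ M ∧ ∀ ζ : V,
      Integrable (fun ξ : V => (1 + ‖ξ + ζ‖) ^ (-β) * (1 + ‖ξ‖) ^ (-β)) ∧
      ∫ ξ : V, (1 + ‖ξ + ζ‖) ^ (-β) * (1 + ‖ξ‖) ^ (-β) ≤ M * (1 + ‖ζ‖) ^ (-κ) := by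
  -- This `κ` uses up half of the margin `2 * β - dim`, so the remaining power is still integrable.
  obtain ⟨κ, hκ, hκ'⟩ : ∃ κ : ℝ, 0 < κ ∧ (Module.finrank ℝ V : ℝ) < 2 * (β - κ) :=
    ⟨(2 * β - Module.finrank ℝ V) / 4, by linarith, by linarith⟩
  have hint : Integrable (fun ξ : V => (1 + ‖ξ‖) ^ (-(2 * (β - κ)))) :=
    integrable_one_add_norm hκ'
  refine ⟨κ, hκ, 2 * ∫ ξ : V, (1 + ‖ξ‖) ^ (-(2 * (β - κ))),
    mul_nonneg zero_le_two (integral_nonneg fun ξ => by positivity), fun ζ => ?_⟩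
  have hint' : Integrable (fun ξ : V => (1 + ‖ξ + ζ‖) ^ (-(2 * (β - κ)))) :=
    hint.comp_add_right ζ
  have hdom := (hint'.add hint).const_mul ((1 + ‖ζ‖) ^ (-κ))
  have hI : Integrable (fun ξ : V => (1 + ‖ξ + ζ‖) ^ (-β) * (1 + ‖ξ‖) ^ (-β)) := by
    refine hdom.mono (Measurable.aestronglyMeasurable (by fun_prop))
      (Filter.Eventually.of_forall fun ξ => ?_)
    rw [Real.norm_of_nonneg (by positivity)]
    exact (one_add_norm_rpow_mul_le hκ.le ξ ζ).trans (le_abs_self _)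
  refine ⟨hI, (integral_mono hI hdom fun ξ => one_add_norm_rpow_mul_le hκ.le ξ ζ).trans_eq ?_⟩
  simp only [Pi.add_apply]
  rw [integral_const_mul, integral_add hint' hint,
    integral_add_right_eq_self (fun ξ : V => (1 + ‖ξ‖) ^ (-(2 * (β - κ))))]
  ring

end GaussianKernel

/-! ### Mollified correlations of measures. -/

section Energy

open Filter Topology

variable {V : Type*} [NormedAddCommGroup V] [InnerProductSpace ℝ V] [FiniteDimensional ℝ V]
  [MeasurableSpace V] [BorelSpace V]

lemma norm_integral_gaussKernel_sub_mul_char_le {ν : Measure V} [IsFiniteMeasure ν] {β D : ℝ}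
    (hν : ∀ ξ, ‖charFun ν ξ‖ ≤ D * (1 + ‖ξ‖) ^ (-β)) {t : ℝ} (ht : 0 < t) (ζ : V)
    (hint : Integrable (fun ξ : V => (1 + ‖ξ + ζ‖) ^ (-β) * (1 + ‖ξ‖) ^ (-β))) :
    ‖∫ p, Complex.exp ((inner ℝ p.1 ζ : ℝ) * Complex.I) * (gaussKernel t (p.1 - p.2) : ℂ)
        ∂(ν.prod ν)‖ ≤
      D ^ 2 * ∫ ξ : V, (1 + ‖ξ + ζ‖) ^ (-β) * (1 + ‖ξ‖) ^ (-β) := by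
  rw [integral_gaussKernel_sub_mul_char ν ν ht, ← integral_const_mul]
  refine norm_integral_le_of_norm_le (hint.const_mul _) (Eventually.of_forall fun ξ => ?_)
  rw [norm_mul, norm_mul, norm_cexp_neg_mul_sq_norm]
  have h1 : Real.exp (-t * ‖ξ‖ ^ 2) ≤ 1 :=
    Real.exp_le_one_iff.2 (by nlinarith [mul_nonneg ht.le (sq_nonneg ‖ξ‖)])
  have h2 := hν (-ξ)
  rw [norm_neg] at h2
  calc _ ≤ 1 * ((D * (1 + ‖ξ + ζ‖) ^ (-β)) * (D * (1 + ‖ξ‖) ^ (-β))) := by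
        refine mul_le_mul h1 (mul_le_mul (hν _) h2 (norm_nonneg _) ?_) (by positivity) zero_le_one
        exact (norm_nonneg _).trans (hν _)
    _ = _ := by ring

/-- The correlation energy of a measure with enough Fourier decay does not concentrate at the
origin, uniformly in the scale `t` of the mollification. -/
lemma exists_tendsto_integral_gaussKernel_le [Nontrivial V] {ν : Measure V} [IsFiniteMeasure ν]
    {β D : ℝ} (hν : ∀ ξ, ‖charFun ν ξ‖ ≤ D * (1 + ‖ξ‖) ^ (-β))
    (hβ : (Module.finrank ℝ V : ℝ) < 2 * β) :
    ∃ ω : ℝ → ℝ, Tendsto ω atTop (𝓝 0) ∧ ∀ s t : ℝ, 0 < t →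
      ∫ p, gaussKernel t (p.1 - p.2) * gaussKernel 1 (s • p.1) ∂(ν.prod ν) ≤ ω s := by
  obtain ⟨κ, hκ, M, hM, h⟩ := exists_integral_one_add_norm_rpow_mul_le (V := V) hβ
  have hexp : Integrable (fun z : V => Real.exp (-1 * ‖z‖ ^ 2)) :=
    integrable_exp_neg_mul_sq_norm one_pos
  have hle1 : ∀ (s : ℝ) (z : V), (1 + ‖s • z‖) ^ (-κ) ≤ 1 := fun s z =>
    Real.rpow_le_one_of_one_le_of_nonpos (by linarith [norm_nonneg (s • z)]) (by linarith)
  have hbd : ∀ (s : ℝ) (z : V), ‖Real.exp (-1 * ‖z‖ ^ 2) * (D ^ 2 * (M * (1 + ‖s • z‖) ^ (-κ)))‖ ≤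
      Real.exp (-1 * ‖z‖ ^ 2) * (D ^ 2 * M) := fun s z => by
    rw [Real.norm_of_nonneg (by positivity)]
    gcongr
    exact mul_le_of_le_one_right hM (hle1 s z)
  -- Expanding the cutoff `gaussKernel 1 (s • p.1)` into characters of frequency `s • z` gives a
  -- Gaussian average of autocorrelations, each decaying as `s → ∞` when `z ≠ 0`.
  refine ⟨fun s => ∫ z : V, Real.exp (-1 * ‖z‖ ^ 2) * (D ^ 2 * (M * (1 + ‖s • z‖) ^ (-κ))),
    ?_, fun s t ht => ?_⟩
  · rw [← integral_zero V ℝ (μ := volume)]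
    refine tendsto_integral_filter_of_dominated_convergence _
      (Eventually.of_forall fun s => Measurable.aestronglyMeasurable (by fun_prop))
      (Eventually.of_forall fun s => Eventually.of_forall (hbd s))
      (hexp.mul_const (D ^ 2 * M)) ?_
    have hne : ∀ᵐ z : V, z ≠ 0 := by simp [ae_iff]
    filter_upwards [hne] with z hz
    have hz' : 0 < ‖z‖ := norm_pos_iff.2 hz
    have h1 : Tendsto (fun s : ℝ => 1 + ‖s • z‖) atTop atTop := by
      simp_rw [norm_smul]
      refine tendsto_atTop_add_const_left _ _ (Tendsto.atTop_mul_const hz' ?_)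
      exact tendsto_norm_atTop_atTop
    have h2 := ((((tendsto_rpow_neg_atTop hκ).comp h1).const_mul M).const_mul (D ^ 2)).const_mul
      (Real.exp (-1 * ‖z‖ ^ 2))
    simpa using h2
  · have hf : Integrable (fun p : V × V => (gaussKernel t (p.1 - p.2) : ℂ)) (ν.prod ν) := by
      refine Integrable.of_bound (C := (Real.pi / t) ^ (Module.finrank ℝ V / 2 : ℝ)) ?_ ?_
      · refine Continuous.aestronglyMeasurable ?_
        have := continuous_gaussKernel (V := V) t
        fun_prop
      · refine Eventually.of_forall fun p => ?_
        rw [Complex.norm_real, Real.norm_of_nonneg (gaussKernel_nonneg ht _)]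
        exact gaussKernel_le ht _
    have key := integral_mul_gaussKernel (V := V) (ν.prod ν) one_pos
      (u := fun p : V × V => s • p.1) (by fun_prop) hf
    have hre : ((∫ p, gaussKernel t (p.1 - p.2) * gaussKernel 1 (s • p.1) ∂(ν.prod ν) : ℝ) : ℂ) =
        ∫ p, (gaussKernel t (p.1 - p.2) : ℂ) * (gaussKernel 1 (s • p.1) : ℂ) ∂(ν.prod ν) := by
      rw [← integral_complex_ofReal]
      simp
    refine (Real.le_norm_self _).trans ?_
    rw [← Complex.norm_real, hre, key]
    refine norm_integral_le_of_norm_le ?_ (Eventually.of_forall fun z => ?_)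
    · exact (hexp.mul_const (D ^ 2 * M)).mono (Measurable.aestronglyMeasurable (by fun_prop))
        (Eventually.of_forall fun z => (hbd s z).trans (le_abs_self _))
    · rw [norm_mul, norm_cexp_neg_mul_sq_norm]
      refine mul_le_mul_of_nonneg_left ?_ (Real.exp_nonneg _)
      have hin := norm_integral_gaussKernel_sub_mul_char_le hν ht (s • z) (h (s • z)).1
      simp_rw [real_inner_smul_right] at hin
      simp_rw [real_inner_smul_left, mul_comm (gaussKernel t _ : ℂ)]
      exact hin.trans (mul_le_mul_of_nonneg_left (h (s • z)).2 (sq_nonneg D))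

/-- The mollified correlation of two measures with nonnegative Fourier transforms
is bounded below. -/
lemma exists_le_integral_gaussKernel {ν₁ ν₂ : Measure V} [IsFiniteMeasure ν₁] [IsFiniteMeasure ν₂]
    (h₁ : ν₁ ≠ 0) (h₂ : ν₂ ≠ 0) {ψ₁ ψ₂ : V → ℝ} (hψ₁ : ∀ ξ, charFun ν₁ ξ = ψ₁ ξ)
    (hψ₂ : ∀ ξ, charFun ν₂ ξ = ψ₂ ξ) (hn₁ : ∀ ξ, 0 ≤ ψ₁ ξ) (hn₂ : ∀ ξ, 0 ≤ ψ₂ ξ) :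
    ∃ c : ℝ, 0 < c ∧ ∀ t : ℝ, 0 < t → t ≤ 1 →
      c ≤ ∫ p, gaussKernel t (p.1 - p.2) ∂(ν₁.prod ν₂) := by
  have hre₁ : ψ₁ = fun ξ => (charFun ν₁ ξ).re := by ext ξ; simp [hψ₁]
  have hre₂ : ψ₂ = fun ξ => (charFun ν₂ ξ).re := by ext ξ; simp [hψ₂]
  have hc₁ : Continuous ψ₁ := hre₁ ▸ Complex.continuous_re.comp continuous_charFun
  have hc₂ : Continuous ψ₂ := hre₂ ▸ Complex.continuous_re.comp continuous_charFun
  have hb₁ : ∀ ξ, ψ₁ ξ ≤ ν₁.real Set.univ := fun ξ => by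
    have := norm_charFun_le (μ := ν₁) ξ
    rwa [hψ₁, Complex.norm_real, Real.norm_of_nonneg (hn₁ ξ)] at this
  have hb₂ : ∀ ξ, ψ₂ ξ ≤ ν₂.real Set.univ := fun ξ => by
    have := norm_charFun_le (μ := ν₂) ξ
    rwa [hψ₂, Complex.norm_real, Real.norm_of_nonneg (hn₂ ξ)] at this
  have hI : ∀ t : ℝ, 0 < t →
      Integrable (fun ξ : V => Real.exp (-t * ‖ξ‖ ^ 2) * (ψ₁ ξ * ψ₂ (-ξ))) := fun t ht => by
    refine ((integrable_exp_neg_mul_sq_norm (V := V) ht).mul_const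
      (ν₁.real Set.univ * ν₂.real Set.univ)).mono
      (Continuous.aestronglyMeasurable (by fun_prop)) (Eventually.of_forall fun ξ => ?_)
    rw [Real.norm_of_nonneg (mul_nonneg (Real.exp_nonneg _) (mul_nonneg (hn₁ _) (hn₂ _))),
      Real.norm_of_nonneg (by positivity)]
    exact mul_le_mul_of_nonneg_left (mul_le_mul (hb₁ _) (hb₂ _) (hn₂ _) measureReal_nonneg)
      (Real.exp_nonneg _)
  have heq : ∀ t : ℝ, 0 < t → ∫ p, gaussKernel t (p.1 - p.2) ∂(ν₁.prod ν₂) =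
      ∫ ξ : V, Real.exp (-t * ‖ξ‖ ^ 2) * (ψ₁ ξ * ψ₂ (-ξ)) := fun t ht => by
    have h := integral_gaussKernel_sub_mul_char ν₁ ν₂ ht 0
    simp only [inner_zero_right, Complex.ofReal_zero, zero_mul, Complex.exp_zero, one_mul,
      add_zero, hψ₁, hψ₂] at h
    rw [integral_complex_ofReal] at h
    rw [← Complex.ofReal_inj, h, ← integral_complex_ofReal]
    push_cast
    rfl
  -- The value at `t = 1` is the minimum, as the integrand decreases in `t`; it is positive because
  -- at `ξ = 0` the integrand is the product of the masses.
  refine ⟨∫ ξ : V, Real.exp (-1 * ‖ξ‖ ^ 2) * (ψ₁ ξ * ψ₂ (-ξ)), ?_, fun t ht ht1 => ?_⟩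
  · refine integral_pos_of_integrable_nonneg_nonzero (x := 0) (by fun_prop) (hI 1 one_pos)
      (fun ξ => mul_nonneg (Real.exp_nonneg _) (mul_nonneg (hn₁ _) (hn₂ _))) ?_
    have : NeZero ν₁ := ⟨h₁⟩
    have : NeZero ν₂ := ⟨h₂⟩
    simp [hre₁, hre₂, charFun_zero, measureReal_eq_zero_iff, h₁, h₂]
  · rw [heq t ht]
    refine integral_mono (hI 1 one_pos) (hI t ht) fun ξ => ?_
    refine mul_le_mul_of_nonneg_right (Real.exp_le_exp.2 ?_) (mul_nonneg (hn₁ _) (hn₂ _))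
    nlinarith [sq_nonneg ‖ξ‖]

lemma tendsto_rpow_mul_exp_neg_div (d : ℝ) {r : ℝ} (hr : 0 < r) :
    Tendsto (fun t : ℝ => (Real.pi / t) ^ d * Real.exp (-(r ^ 2 / (4 * t)))) (𝓝[>] 0) (𝓝 0) := by
  have h := (tendsto_rpow_mul_exp_neg_mul_atTop_nhds_zero d (r ^ 2 / (4 * Real.pi))
    (by positivity)).comp
    ((tendsto_inv_nhdsGT_zero (𝕜 := ℝ)).const_mul_atTop Real.pi_pos)
  refine h.congr fun t => ?_
  simp only [Function.comp_apply, div_eq_mul_inv, mul_inv]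
  congr 2
  field_simp

/-- Two nonzero measures dominated by a measure with Fourier decay `β > dim / 2`, and having
nonnegative Fourier transforms, cannot be carried by compact sets meeting only at the origin. -/
theorem exists_mem_inter_ne_zero [Nontrivial V] {ν ν₁ ν₂ : Measure V} [IsFiniteMeasure ν]
    (hle₁ : ν₁ ≤ ν) (hle₂ : ν₂ ≤ ν) {β D : ℝ}
    (hν : ∀ ξ, ‖charFun ν ξ‖ ≤ D * (1 + ‖ξ‖) ^ (-β)) (hβ : (Module.finrank ℝ V : ℝ) < 2 * β)
    (h₁ : ν₁ ≠ 0) (h₂ : ν₂ ≠ 0) {ψ₁ ψ₂ : V → ℝ} (hψ₁ : ∀ ξ, charFun ν₁ ξ = ψ₁ ξ)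
    (hψ₂ : ∀ ξ, charFun ν₂ ξ = ψ₂ ξ) (hn₁ : ∀ ξ, 0 ≤ ψ₁ ξ) (hn₂ : ∀ ξ, 0 ≤ ψ₂ ξ)
    {D₁ D₂ : Set V} (hD₁ : IsCompact D₁) (hD₂ : IsCompact D₂)
    (hm₁ : ∀ᵐ x ∂ν₁, x ∈ D₁) (hm₂ : ∀ᵐ x ∂ν₂, x ∈ D₂) : ∃ x ∈ D₁ ∩ D₂, x ≠ 0 := by
  by_contra! hcon
  have : IsFiniteMeasure ν₁ := isFiniteMeasure_of_le ν hle₁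
  have : IsFiniteMeasure ν₂ := isFiniteMeasure_of_le ν hle₂
  obtain ⟨ω, hω, hωle⟩ := exists_tendsto_integral_gaussKernel_le hν hβ
  obtain ⟨c, hc, hcle⟩ := exists_le_integral_gaussKernel h₁ h₂ hψ₁ hψ₂ hn₁ hn₂
  -- `A` is the value of `gaussKernel 1` on the unit sphere, a lower bound on the unit ball.
  set A : ℝ := Real.pi ^ (Module.finrank ℝ V / 2 : ℝ) * Real.exp (-(1 / 4)) with hA
  have hA0 : 0 < A := by positivity
  -- Order of choice: `s` fixes the ball around `0`, then `r` the separation outside it, and only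
  -- then `t`. This works because `ω` does not depend on `t`.
  obtain ⟨s, hs0, hs⟩ : ∃ s : ℝ, 0 < s ∧ A⁻¹ * ω s < c / 2 := by
    have h := (hω.const_mul A⁻¹).eventually_lt_const (u := c / 2) (by simpa using hc)
    exact ((eventually_gt_atTop 0).and h).exists
  obtain ⟨r, hr0, hr⟩ : ∃ r : ℝ, 0 < r ∧
      ∀ u ∈ D₁ \ Metric.ball 0 s⁻¹, ∀ v ∈ D₂, r ≤ ‖u - v‖ := by
    have hdisj : Disjoint (D₁ \ Metric.ball 0 s⁻¹) D₂ := by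
      rw [Set.disjoint_left]
      rintro u ⟨hu, hu'⟩ hv
      exact hu' (by simpa [hcon u ⟨hu, hv⟩] using hs0)
    obtain ⟨r, hr, h⟩ := Metric.exists_pos_forall_lt_edist (hD₁.diff Metric.isOpen_ball)
      hD₂.isClosed hdisj
    refine ⟨r, hr, fun u hu v hv => ?_⟩
    have := h u hu v hv
    rw [edist_nndist, ENNReal.coe_lt_coe] at this
    rw [← dist_eq_norm]
    exact_mod_cast this.le
  set m := (ν₁.prod ν₂).real Set.univ
  have hlim := (tendsto_rpow_mul_exp_neg_div (Module.finrank ℝ V / 2) hr0).const_mul m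
  rw [mul_zero] at hlim
  obtain ⟨t, ⟨ht0, ht1⟩, ht⟩ := ((Filter.eventually_mem_set.2
    (Ioc_mem_nhdsGT (zero_lt_one (α := ℝ)))).and
    (hlim.eventually_lt_const (u := c / 2) (by linarith))).exists
  have hcont := continuous_gaussKernel (V := V)
  have hint : ∀ (ρ : Measure (V × V)) [IsFiniteMeasure ρ],
      Integrable (fun p : V × V => gaussKernel t (p.1 - p.2)) ρ := fun ρ _ => by
    refine Integrable.of_bound (C := (Real.pi / t) ^ (Module.finrank ℝ V / 2 : ℝ))
      (Continuous.aestronglyMeasurable (by have := hcont t; fun_prop))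
      (Eventually.of_forall fun p => ?_)
    rw [Real.norm_of_nonneg (gaussKernel_nonneg ht0 _)]
    exact gaussKernel_le ht0 _
  have hint2 : ∀ (ρ : Measure (V × V)) [IsFiniteMeasure ρ],
      Integrable (fun p : V × V => gaussKernel t (p.1 - p.2) * gaussKernel 1 (s • p.1)) ρ :=
    fun ρ _ => by
      refine (hint ρ).mul_bdd (c := (Real.pi / 1) ^ (Module.finrank ℝ V / 2 : ℝ))
        (Continuous.aestronglyMeasurable (by have := hcont 1; fun_prop))
        (Eventually.of_forall fun p => ?_)
      rw [Real.norm_of_nonneg (gaussKernel_nonneg one_pos _)]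
      exact gaussKernel_le one_pos _
  set B := (Real.pi / t) ^ (Module.finrank ℝ V / 2 : ℝ) * Real.exp (-(r ^ 2 / (4 * t))) with hB
  have hB0 : 0 ≤ B := by positivity
  have hpt : ∀ᵐ p ∂(ν₁.prod ν₂), gaussKernel t (p.1 - p.2) ≤
      A⁻¹ * (gaussKernel t (p.1 - p.2) * gaussKernel 1 (s • p.1)) + B := by
    filter_upwards [Measure.quasiMeasurePreserving_fst.ae hm₁,
      Measure.quasiMeasurePreserving_snd.ae hm₂] with p hp1 hp2
    have hg := gaussKernel_nonneg ht0 (p.1 - p.2)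
    have hg1 := gaussKernel_nonneg one_pos (s • p.1)
    by_cases hp : p.1 ∈ Metric.ball (0 : V) s⁻¹
    · have hsp : ‖s • p.1‖ ≤ 1 := by
        rw [mem_ball_zero_iff] at hp
        rw [norm_smul, Real.norm_of_nonneg hs0.le]
        calc s * ‖p.1‖ ≤ s * s⁻¹ := by gcongr
          _ = 1 := mul_inv_cancel₀ hs0.ne'
      have hge : A ≤ gaussKernel 1 (s • p.1) := by
        rw [hA, gaussKernel, div_one, mul_one]
        gcongr
        exact pow_le_one₀ (norm_nonneg _) hsp
      have : gaussKernel t (p.1 - p.2) * 1 ≤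
          gaussKernel t (p.1 - p.2) * (A⁻¹ * gaussKernel 1 (s • p.1)) := by
        refine mul_le_mul_of_nonneg_left ?_ hg
        rwa [inv_mul_eq_div, one_le_div hA0]
      linarith
    · have := gaussKernel_le_of_le_norm ht0 hr0.le (hr p.1 ⟨hp1, hp⟩ p.2 hp2)
      have h0 : 0 ≤ A⁻¹ * (gaussKernel t (p.1 - p.2) * gaussKernel 1 (s • p.1)) := by positivity
      linarith
  have h1 : ∫ p, gaussKernel t (p.1 - p.2) ∂(ν₁.prod ν₂) ≤
      A⁻¹ * (∫ p, gaussKernel t (p.1 - p.2) * gaussKernel 1 (s • p.1) ∂(ν₁.prod ν₂)) + m * B := by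
    refine (integral_mono_ae (hint _)
      (((hint2 _).const_mul _).add (integrable_const B)) hpt).trans_eq ?_
    simp only [Pi.add_apply]
    rw [integral_add ((hint2 _).const_mul _) (integrable_const B), integral_const_mul,
      integral_const, smul_eq_mul]
  -- Fourier decay is known only for `ν`; nonnegativity of the kernels lets the energy of `ν` bound
  -- this one.
  have h2 : ∫ p, gaussKernel t (p.1 - p.2) * gaussKernel 1 (s • p.1) ∂(ν₁.prod ν₂) ≤
      ∫ p, gaussKernel t (p.1 - p.2) * gaussKernel 1 (s • p.1) ∂(ν.prod ν) :=
    integral_mono_measure (Measure.prod_mono hle₁ hle₂)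
      (Eventually.of_forall fun p =>
        mul_nonneg (gaussKernel_nonneg ht0 _) (gaussKernel_nonneg one_pos _)) (hint2 _)
  have h3 := mul_le_mul_of_nonneg_left (h2.trans (hωle s t ht0)) (inv_nonneg.2 hA0.le)
  linarith [hcle t ht0 ht1]

end Energy

/-! ### Laws of differences. -/

section DifferenceLaw

variable {V : Type*} [NormedAddCommGroup V] [InnerProductSpace ℝ V] [FiniteDimensional ℝ V]
  [MeasurableSpace V] [BorelSpace V]

/-- The distribution of the difference of two independent copies. -/
noncomputable def differenceLaw (μ : Measure V) : Measure V :=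
  (μ.prod μ).map (fun p => p.1 - p.2)

instance (μ : Measure V) [IsFiniteMeasure μ] : IsFiniteMeasure (differenceLaw μ) := by
  unfold differenceLaw
  infer_instance

lemma differenceLaw_mono {μ ν : Measure V} [SFinite ν] (h : μ ≤ ν) [SFinite μ] :
    differenceLaw μ ≤ differenceLaw ν :=
  Measure.map_mono (Measure.prod_mono h h) (by fun_prop)

lemma differenceLaw_ne_zero {μ : Measure V} [SFinite μ] (h : μ ≠ 0) : differenceLaw μ ≠ 0 := by
  intro h0
  have := congrArg (fun ν => ν Set.univ) h0
  rw [differenceLaw, Measure.map_apply (by fun_prop) MeasurableSet.univ] at this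
  rw [Set.preimage_univ, ← Set.univ_prod_univ, Measure.prod_prod] at this
  simp [h] at this

lemma charFun_differenceLaw (μ : Measure V) [IsFiniteMeasure μ] (ξ : V) :
    charFun (differenceLaw μ) ξ = ((‖charFun μ ξ‖ ^ 2 : ℝ) : ℂ) := by
  rw [charFun_apply, differenceLaw, integral_map (by fun_prop)
    (Continuous.aestronglyMeasurable (by fun_prop))]
  have h := Complex.mul_conj (charFun μ ξ)
  rw [Complex.normSq_eq_norm_sq, ← charFun_neg] at h
  rw [← h, charFun_apply, charFun_apply, ← integral_prod_mul]
  refine integral_congr_ae (Filter.Eventually.of_forall fun p => ?_)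
  simp only [← Complex.exp_add]
  congr 1
  simp only [inner_sub_left, inner_neg_right]
  push_cast
  ring

lemma ae_differenceLaw_mem {μ : Measure V} [SFinite μ] {K : Set V} (hK : IsCompact K)
    (h : ∀ᵐ x ∂μ, x ∈ K) :
    ∀ᵐ x ∂(differenceLaw μ), x ∈ (fun p : V × V => p.1 - p.2) '' (K ×ˢ K) := by
  have hc : IsCompact ((fun p : V × V => p.1 - p.2) '' (K ×ˢ K)) :=
    (hK.prod hK).image (by fun_prop)
  refine (ae_map_iff (by fun_prop) hc.measurableSet).2 ?_
  filter_upwards [Measure.quasiMeasurePreserving_fst.ae h,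
    Measure.quasiMeasurePreserving_snd.ae h] with p h1 h2
  exact ⟨p, ⟨h1, h2⟩, rfl⟩

end DifferenceLaw

/-! ### Using the hypotheses on `μ`, and the conclusion. -/

lemma norm_charFun_le_of_fourierDecay {n : ℕ} {μ : Measure (EuclideanSpace ℝ (Fin n))} {β C : ℝ}
    (hβ : 0 ≤ β) (h : FourierDecay μ β C) (ξ : EuclideanSpace ℝ (Fin n)) :
    ‖charFun μ ξ‖ ≤ (2 * Real.pi) ^ (β / 2) * C * (1 + ‖ξ‖) ^ (-(β / 2)) := by
  have hpi : 1 ≤ 2 * Real.pi := by linarith [Real.pi_gt_three]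
  have heq : charFun μ ξ = measureFourier μ (-(2 * Real.pi)⁻¹ • ξ) := by
    rw [charFun_apply, measureFourier]
    refine integral_congr_ae (Filter.Eventually.of_forall fun x => ?_)
    simp only [real_inner_smul_right]
    congr 1
    push_cast
    have : (Real.pi : ℂ) ≠ 0 := Complex.ofReal_ne_zero.2 Real.pi_ne_zero
    field_simp
  have h1 := h (-(2 * Real.pi)⁻¹ • ξ)
  rw [← heq, norm_smul, norm_neg, Real.norm_of_nonneg (by positivity)] at h1
  have h2 : (1 + ‖ξ‖) ^ (β / 2) ≤
      (2 * Real.pi) ^ (β / 2) * (1 + (2 * Real.pi)⁻¹ * ‖ξ‖) ^ (β / 2) := by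
    rw [← Real.mul_rpow (by positivity) (by positivity)]
    refine Real.rpow_le_rpow (by positivity) ?_ (by positivity)
    rw [mul_add, mul_inv_cancel_left₀ (by positivity)]
    linarith
  rw [Real.rpow_neg (by positivity), ← div_eq_mul_inv, le_div_iff₀ (by positivity)]
  calc _ ≤ ‖charFun μ ξ‖ *
        ((2 * Real.pi) ^ (β / 2) * (1 + (2 * Real.pi)⁻¹ * ‖ξ‖) ^ (β / 2)) := by gcongr
    _ = (2 * Real.pi) ^ (β / 2) *
        (‖charFun μ ξ‖ * (1 + (2 * Real.pi)⁻¹ * ‖ξ‖) ^ (β / 2)) := by ring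
    _ ≤ _ := by gcongr

lemma measure_singleton_eq_zero_of_ballCondition {n : ℕ} {E : Set (EuclideanSpace ℝ (Fin n))}
    {μ : Measure (EuclideanSpace ℝ (Fin n))} [IsFiniteMeasure μ] {α C : ℝ} (hα : 0 < α)
    (h : BallCondition E μ α C) {p : EuclideanSpace ℝ (Fin n)} (hp : p ∈ E) : μ {p} = 0 := by
  have hle : ∀ᶠ r : ℝ in nhdsWithin 0 (Set.Ioi 0), μ.real {p} ≤ C * r ^ α := by
    filter_upwards [Ioo_mem_nhdsGT (zero_lt_one (α := ℝ))] with r hr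
    have h1 := h p hp r hr.1 hr.2
    rw [div_le_iff₀ (Real.rpow_pos_of_pos hr.1 _)] at h1
    exact (measureReal_mono (by simpa using hr.1)).trans h1
  have hlim : Filter.Tendsto (fun r : ℝ => C * r ^ α) (nhdsWithin 0 (Set.Ioi 0)) (nhds 0) := by
    have := ((Real.continuousAt_rpow_const 0 α (Or.inr hα.le)).tendsto.mono_left
      (nhdsWithin_le_nhds (s := Set.Ioi 0))).const_mul C
    simpa [Real.zero_rpow hα.ne'] using this
  have h0 : μ.real {p} ≤ 0 := ge_of_tendsto hlim hle
  exact (measureReal_eq_zero_iff (measure_ne_top _ _)).1 (le_antisymm h0 measureReal_nonneg)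

theorem mainTheorem3 (n : ℕ) (hn : 1 ≤ n) (C : ℝ) :
    ∃ ε₀ : ℝ, 0 < ε₀ ∧
      ∀ (α β : ℝ), (n : ℝ) - ε₀ < α → α < n → (n : ℝ) / 2 < β → β < n →
      ∀ (E : Set (EuclideanSpace ℝ (Fin n))), volume E = 0 →
      ∀ (μ : Measure (EuclideanSpace ℝ (Fin n))), IsFiniteMeasure μ → μ ≠ 0 →
        μ.support ⊆ E → BallCondition E μ α C → FourierDecay μ β C →
        ContainsParallelogram E := by
  have hn' : (1 : ℝ) ≤ n := by exact_mod_cast hn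
  -- With `ε₀ = 1` and `n ≥ 1` one gets `α > 0`, enough to exclude atoms on `E`.
  refine ⟨1, one_pos, fun α β hα _ hβ _ E _ μ _ hμ hE hball hdecay => ?_⟩
  have hrank : Module.finrank ℝ (EuclideanSpace ℝ (Fin n)) = n := by simp
  have : Nontrivial (EuclideanSpace ℝ (Fin n)) :=
    Module.nontrivial_of_finrank_pos (R := ℝ) (by omega)
  obtain ⟨p, hp⟩ := Measure.nonempty_support hμ
  have hp0 := measure_singleton_eq_zero_of_ballCondition (by linarith) hball (hE hp)
  obtain ⟨q, hq, hpq⟩ : ∃ q ∈ μ.support, q ≠ p := by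
    by_contra! hcon
    refine hμ (Measure.measure_univ_eq_zero.1 (measure_mono_null ?_
      (measure_union_null (Measure.measure_compl_support (μ := μ)) hp0)))
    intro x _
    by_cases hx : x ∈ μ.support
    · exact Or.inr (hcon x hx)
    · exact Or.inl hx
  set r := dist q p / 3
  have hr : 0 < r := div_pos (dist_pos.2 hpq) (by norm_num)
  have hdisj : ∀ x ∈ Metric.closedBall p r, ∀ y ∈ Metric.closedBall q r, x ≠ y := by
    rintro x hx _ hy rfl
    rw [Metric.mem_closedBall] at hx hy
    have := dist_triangle_left q p x
    have h3 : dist q p = 3 * r := by simp only [r]; ring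
    linarith
  have hpos : ∀ w ∈ μ.support, μ.restrict (Metric.closedBall w r) ≠ 0 := fun w hw => by
    rw [Ne, Measure.restrict_eq_zero]
    exact ((Measure.mem_support_iff_forall w).1 hw _ (Metric.closedBall_mem_nhds w hr)).ne'
  have hK : ∀ w, IsCompact (Metric.closedBall w r ∩ μ.support) := fun w =>
    (isCompact_closedBall w r).inter_right Measure.isClosed_support
  have hae : ∀ w, ∀ᵐ x ∂(μ.restrict (Metric.closedBall w r)),
      x ∈ Metric.closedBall w r ∩ μ.support := fun w =>
    (ae_restrict_mem Metric.isClosed_closedBall.measurableSet).and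
      (ae_restrict_of_ae Measure.support_mem_ae)
  have hD : ∀ w, IsCompact ((fun p : _ × _ => p.1 - p.2) ''
      ((Metric.closedBall w r ∩ μ.support) ×ˢ (Metric.closedBall w r ∩ μ.support))) := fun w =>
    ((hK w).prod (hK w)).image (by fun_prop)
  obtain ⟨_, ⟨⟨⟨a, c⟩, ⟨ha, hc⟩, rfl⟩, ⟨⟨e, f⟩, ⟨he, hf⟩, hef⟩⟩, hne⟩ :=
    exists_mem_inter_ne_zero (ν := differenceLaw μ)
      (differenceLaw_mono (Measure.restrict_le_self (s := Metric.closedBall p r)))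
      (differenceLaw_mono (Measure.restrict_le_self (s := Metric.closedBall q r)))
      -- Passing to differences squares the transform, doubling the decay exponent from `β / 2` to
      -- `β`.
      (β := β) (D := ((2 * Real.pi) ^ (β / 2) * C) ^ 2)
      (fun ξ => by
        rw [charFun_differenceLaw, Complex.norm_real, Real.norm_of_nonneg (by positivity)]
        refine (pow_le_pow_left₀ (norm_nonneg _)
          (norm_charFun_le_of_fourierDecay (by linarith) hdecay ξ) 2).trans_eq ?_
        rw [mul_pow]
        congr 1
        rw [← Real.rpow_natCast, ← Real.rpow_mul (by positivity)]
        congr 1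
        push_cast
        ring)
      (by rw [hrank]; linarith)
      (differenceLaw_ne_zero (hpos p hp)) (differenceLaw_ne_zero (hpos q hq))
      (charFun_differenceLaw _) (charFun_differenceLaw _)
      (fun ξ => by positivity) (fun ξ => by positivity) (hD p) (hD q)
      (ae_differenceLaw_mem (hK p) (hae p)) (ae_differenceLaw_mem (hK q) (hae q))
  simp only at ha hc he hf hef hne
  have h4 : e = c + (a - c) + (f - c) := by
    rw [← hef]
    abel
  -- The vertices are `c`, `a` in the ball at `p` and `f`, `e` in the ball at `q`, with `a - c = e -
  -- f ≠ 0`.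
  refine ⟨c, a - c, f - c, ?_, ?_⟩
  · rw [← h4, add_sub_cancel, add_sub_cancel]
    rintro x (rfl | rfl | rfl | rfl)
    exacts [hE hc.2, hE ha.2, hE hf.2, hE he.2]
  · rw [← h4, add_sub_cancel, add_sub_cancel]
    have hca : c ≠ a := fun h => hne (by rw [h, sub_self])
    have hfe : f ≠ e := fun h => hne (by rw [← hef, h, sub_self])
    simp [hca, hfe, hdisj c hc.1 f hf.1, hdisj c hc.1 e he.1, hdisj a ha.1 f hf.1,
      hdisj a ha.1 e he.1]
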